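/- Let $d$ be a dimension and let $(\{X\},\{Y\},T)$ be a random triple, defined on a probability space $(\Omega,\mathcal F,\mathbb P)$, of two locally finite point sets $\{X\},\{Y\}\subset\mathbb R^d$ and a bijection $T$ of $\{X\}$ onto $\{Y\}$, such that the number $N_{U,V}:=\#\{(X,Y)\in U\times V : Y=T(X)\}$ is measurable for all Borel sets $U,V\subset\mathbb R^d$. Assume that (i) $\{X\}$ and $\{Y\}$ are independent Poisson point processes of unit intensity; (ii) the law of $(\{X\},\{Y\},T)$, on the $\sigma$-algebra generated by the observables $N_{U,V}$, is invariant (stationary) and ergodic under the action of $\mathbb Z^d\ni\bar x$ given by $(\{X\},\{Y\},T)\mapsto(\{\bar x+X\},\{\bar x+Y\},T(\cdot-\bar x)+\bar x)$; (iii) almost surely, $T$ is cyclically monotone, i.e. for every finite subset $\{X_n\}_{n=1}^N$ of $\{X\}$ (enumerated in any way) one has $\sum_{n=1}^N T(X_n)\cdot(X_n-X_{n-1})\ge 0$, where $X_0:=X_N$. Then for every $\varepsilon>0$ there exists a random radius (a measurable map) $r_*:\Omega\to(0,\infty)$ such that almost surely, for every real $R\ge r_*$ and every point $X\in\{X\}\cap(-R,R)^d$,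 $$|T(X)-X|\le\varepsilon R .$$ -/

import Mathlib

open MeasureTheory ProbabilityTheory

noncomputable section

/-- `d`-dimensional Euclidean space. -/
abbrev Space (d : ℕ) : Type := EuclideanSpace ℝ (Fin d)

/-- A locally finite point set `{X} ⊂ ℝ^d`. -/
@[ext]
structure PointConfig (d : ℕ) where
  carrier : Set (Space d)
  locallyFinite : ∀ B : Set (Space d), Bornology.IsBounded B → (carrier ∩ B).Finite

namespace PointConfig

variable {d : ℕ}

/-- The number `#{X ∈ B}` of points in `B`. -/
def count (ξ : PointConfig d) (B : Set (Space d)) : ℕ∞ := (ξ.carrier ∩ B).encard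

/-- The σ-algebra generated by the numbers of points in Borel sets. -/
instance : MeasurableSpace (PointConfig d) :=
  ⨆ (B : Set (Space d)) (_ : MeasurableSet B),
    MeasurableSpace.comap (fun ξ : PointConfig d => ξ.count B) inferInstance

/-- The shifted point set `{v + X}`. -/
def shift (v : Space d) (ξ : PointConfig d) : PointConfig d where
  carrier := {z | z - v ∈ ξ.carrier}
  locallyFinite B hB := by
    have hB' : Bornology.IsBounded ((fun z => z - v) '' B) := by
      obtain ⟨C, hC⟩ := isBounded_iff_forall_norm_le.mp hB
      refine isBounded_iff_forall_norm_le.mpr ⟨C + ‖v‖, ?_⟩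
      rintro _ ⟨z, hz, rfl⟩
      exact (norm_sub_le z v).trans (by linarith [hC z hz])
    refine Set.Finite.of_finite_image (f := fun z => z - v)
      ((ξ.locallyFinite _ hB').subset ?_) (sub_left_injective.injOn)
    rintro _ ⟨z, ⟨hz, hzB⟩, rfl⟩
    exact ⟨hz, z, hzB, rfl⟩

end PointConfig

/-- A random point set `ξ` is a Poisson point process of unit intensity: the number of points in a
Borel set of finite volume is Poisson distributed with the volume as parameter, and the numbers of
points in disjoint sets are independent. -/
structure IsUnitPoissonProcess {d : ℕ} {Ω : Type*} [MeasurableSpace Ω]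
    (ξ : Ω → PointConfig d) (P : Measure Ω) : Prop where
  hasLaw_count : ∀ B : Set (Space d), MeasurableSet B → volume B ≠ ⊤ →
    HasLaw (fun ω => (ξ ω).count B)
      ((poissonMeasure (volume B).toNNReal).map (Nat.cast : ℕ → ℕ∞)) P
  iIndepFun_count : ∀ (n : ℕ) (B : Fin n → Set (Space d)),
    (∀ i, MeasurableSet (B i)) → (∀ i, volume (B i) ≠ ⊤) →
    Pairwise (fun i j => Disjoint (B i) (B j)) →
    iIndepFun (fun i ω => (ξ ω).count (B i)) P

/-- A triple `({X}, {Y}, T)` of two locally finite point sets and a bijection `T` of `{X}` onto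
`{Y}`. -/
structure Matching (d : ℕ) where
  X : PointConfig d
  Y : PointConfig d
  T : X.carrier ≃ Y.carrier

namespace Matching

variable {d : ℕ}

/-- The number `N_{U,V}` of matched pairs `(X, Y) ∈ U × V`. -/
def count (m : Matching d) (U V : Set (Space d)) : ℕ∞ :=
  {x : m.X.carrier | (x : Space d) ∈ U ∧ (m.T x : Space d) ∈ V}.encard

/-- The σ-algebra generated by the observables `N_{U,V}`, `U` and `V` Borel. -/
instance : MeasurableSpace (Matching d) :=
  ⨆ (U : Set (Space d)) (V : Set (Space d)) (_ : MeasurableSet U) (_ : MeasurableSet V),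
    MeasurableSpace.comap (fun m : Matching d => m.count U V) inferInstance

/-- The shift `({v + X}, {v + Y}, T(· - v) + v)`. -/
def shift (v : Space d) (m : Matching d) : Matching d where
  X := m.X.shift v
  Y := m.Y.shift v
  T :=
    { toFun := fun z => ⟨(m.T ⟨z.1 - v, z.2⟩ : Space d) + v, by
        simp [PointConfig.shift]⟩
      invFun := fun z => ⟨(m.T.symm ⟨z.1 - v, z.2⟩ : Space d) + v, by
        simp [PointConfig.shift]⟩
      left_inv := fun z => by simp
      right_inv := fun z => by simp }

/-- The point of `ℝ^d` with the given integer coordinates. -/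
def latticePoint (k : Fin d → ℤ) : Space d := WithLp.toLp 2 fun i => (k i : ℝ)

/-- The additive group `ℤ^d` acts on matchings by shifts. -/
instance : VAdd (Fin d → ℤ) (Matching d) := ⟨fun k m => m.shift (latticePoint k)⟩

/-- Cyclical monotonicity: `∑ T(X_n) · (X_n - X_{n-1}) ≥ 0` for every enumerated finite subset
`X_0, …, X_N` of `{X}`; the index `n - 1` in `Fin (N + 1)` is cyclic, so `X_{0-1} = X_N`. -/
def IsCyclicallyMonotone (m : Matching d) : Prop :=
  ∀ (N : ℕ) (x : Fin (N + 1) → m.X.carrier), Function.Injective x →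
    0 ≤ ∑ n, inner ℝ (m.T (x n) : Space d) ((x n : Space d) - (x (n - 1) : Space d))

end Matching

end

/-! Let `x` have displacement `D`, and suppose that some `y` near the point at distance `ρ` from `x`
in direction `D` has displacement at most `ρ / 2`. Monotonicity on the pair `x, y`, the two-point
case of cyclical monotonicity, then forces `‖D‖ ≤ 6 * ρ` (`norm_displacement_le_of_near`). With `ρ =
ε * R / 6` it remains to find such a `y` near every location close to the cube `(-R, R)^d`.

A lattice point that is not void at scale `L` supplies a `y` within `L` whose displacement is at
most `2 * L`. Void points are rare: a given point is void with probability tending to `0` as `L →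
∞`. Stationarity and a Vitali covering turn this into a maximal inequality over all boxes centred at
the origin (`measure_largeDensity_le`), so almost surely some random `L` keeps the void density
below a prescribed `lam` at every scale. For `lam` a small constant times `ε ^ d`, the void points
cannot fill a box of size comparable to `ε * R` near the cube (`exists_notMem_voidEvent`). -/

/-! ### Lattice boxes and the maximal inequality -/

/-- The discrete cube of side `2 n + 1` centred at `k`. -/
noncomputable def latticeBox {d : ℕ} (k : Fin d → ℤ) (n : ℕ) : Finset (Fin d → ℤ) :=
  Finset.Icc (fun i => k i - n) (fun i => k i + n)

theorem mem_latticeBox {d : ℕ} {k j : Fin d → ℤ} {n : ℕ} :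
    j ∈ latticeBox k n ↔ ∀ i, |j i - k i| ≤ n := by
  simp only [latticeBox, Finset.mem_Icc, Pi.le_def, abs_le, ← forall_and]
  exact forall_congr' fun i => by constructor <;> rintro ⟨h₁, h₂⟩ <;> constructor <;> linarith

/-- In the sup metric of `ℤ^d` boxes are closed balls, which makes the Vitali covering lemma
applicable. -/
theorem mem_latticeBox_iff_dist {d : ℕ} {k j : Fin d → ℤ} {n : ℕ} :
    j ∈ latticeBox k n ↔ dist j k ≤ n := by
  rw [mem_latticeBox, dist_pi_le_iff (Nat.cast_nonneg n)]
  refine forall_congr' fun i => ?_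
  rw [Int.dist_eq]
  exact_mod_cast Iff.rfl

theorem card_latticeBox {d : ℕ} (k : Fin d → ℤ) (n : ℕ) :
    (latticeBox k n).card = (2 * n + 1) ^ d := by
  rw [latticeBox, Pi.card_Icc]
  have : ∀ i : Fin d, (Finset.Icc (k i - n) (k i + n)).card = 2 * n + 1 := by
    intro i
    rw [Int.card_Icc]
    omega
  simp [this]

open Classical in
/-- Vitali covering bound: the set of points around which `Z` has density larger than `lam` at some
scale `n ≤ N` is controlled by the cardinality of `Z`. -/
theorem card_large_density_le {d : ℕ} (Z : Set (Fin d → ℤ)) (lam : ℝ) (hlam : 0 < lam) (K N : ℕ) :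
    lam * ((latticeBox (0 : Fin d → ℤ) K).filter fun k => ∃ n ≤ N,
      lam * (2 * n + 1 : ℝ) ^ d < ((latticeBox k n).filter (· ∈ Z)).card).card
      ≤ 5 ^ d * ((latticeBox (0 : Fin d → ℤ) (K + N)).filter (· ∈ Z)).card := by
  set S := (latticeBox (0 : Fin d → ℤ) K).filter fun k => ∃ n ≤ N,
      lam * (2 * n + 1 : ℝ) ^ d < ((latticeBox k n).filter (· ∈ Z)).card with hS
  have hS' : ∀ k : Fin d → ℤ, ∃ n : ℕ, k ∈ S → n ≤ N ∧
      lam * (2 * n + 1 : ℝ) ^ d < ((latticeBox k n).filter (· ∈ Z)).card := by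
    intro k
    by_cases hk : k ∈ S
    · obtain ⟨n, h⟩ := (Finset.mem_filter.1 hk).2
      exact ⟨n, fun _ => h⟩
    · exact ⟨0, fun h => absurd h hk⟩
  choose n hn using hS'
  obtain ⟨u, huS, hdisj, hcov⟩ := Vitali.exists_disjoint_subfamily_covering_enlargement_closedBall
    (S : Set (Fin d → ℤ)) id (fun k => (n k : ℝ)) N
    (fun k hk => by exact_mod_cast (hn k hk).1) 5 (by norm_num)
  have hufin : u.Finite := S.finite_toSet.subset huS
  set v := hufin.toFinset with hv
  have hvS : ∀ k ∈ v, k ∈ S := fun k hk => huS (hufin.mem_toFinset.1 hk)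
  have hScov : S ⊆ v.biUnion fun k => latticeBox k (5 * n k) := by
    intro k hk
    obtain ⟨b, hb, hsub⟩ := hcov k hk
    refine Finset.mem_biUnion.2 ⟨b, hufin.mem_toFinset.2 hb, ?_⟩
    rw [mem_latticeBox_iff_dist]
    have := hsub (Metric.mem_closedBall_self (Nat.cast_nonneg _))
    simpa using this
  have h1 : (S.card : ℝ) ≤ ∑ k ∈ v, (5 : ℝ) ^ d * (2 * n k + 1 : ℝ) ^ d := by
    calc (S.card : ℝ) ≤ ((v.biUnion fun k => latticeBox k (5 * n k)).card : ℝ) := by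
          exact_mod_cast Finset.card_le_card hScov
      _ ≤ ∑ k ∈ v, ((latticeBox k (5 * n k)).card : ℝ) := by
          exact_mod_cast Finset.card_biUnion_le
      _ ≤ _ := by
          refine Finset.sum_le_sum fun k _ => ?_
          rw [card_latticeBox, ← mul_pow]
          push_cast
          -- Enlarging the radius fivefold costs at most `5 ^ d` in cardinality: `2 * (5 * n) + 1 ≤
          -- 5 * (2 * n + 1)`.
          exact pow_le_pow_left₀ (by positivity) (by nlinarith) d
  have h2 : ∑ k ∈ v, (((latticeBox k (n k)).filter (· ∈ Z)).card : ℝ)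
      ≤ ((latticeBox (0 : Fin d → ℤ) (K + N)).filter (· ∈ Z)).card := by
    have : (v.biUnion fun k => (latticeBox k (n k)).filter (· ∈ Z)).card =
        ∑ k ∈ v, ((latticeBox k (n k)).filter (· ∈ Z)).card := by
      refine Finset.card_biUnion fun a ha b hb hab => ?_
      refine Finset.disjoint_left.2 fun j hja hjb => ?_
      have := hdisj (hufin.mem_toFinset.1 ha) (hufin.mem_toFinset.1 hb) hab
      exact Set.disjoint_left.1 this (mem_latticeBox_iff_dist.1 (Finset.mem_filter.1 hja).1)
        (mem_latticeBox_iff_dist.1 (Finset.mem_filter.1 hjb).1)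
    rw [← Nat.cast_sum, ← this]
    refine Nat.cast_le.2 (Finset.card_le_card fun j hj => ?_)
    obtain ⟨k, hk, hj⟩ := Finset.mem_biUnion.1 hj
    obtain ⟨hj, hjZ⟩ := Finset.mem_filter.1 hj
    refine Finset.mem_filter.2 ⟨?_, hjZ⟩
    have hk0 := mem_latticeBox_iff_dist.1 (Finset.mem_filter.1 (hvS k hk)).1
    have hjk := mem_latticeBox_iff_dist.1 hj
    have hnk : (n k : ℝ) ≤ N := by exact_mod_cast (hn k (hvS k hk)).1
    rw [mem_latticeBox_iff_dist]
    push_cast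
    linarith [dist_triangle j k 0]
  calc lam * (S.card : ℝ) ≤ lam * ∑ k ∈ v, (5 : ℝ) ^ d * (2 * n k + 1 : ℝ) ^ d := by gcongr
    _ = 5 ^ d * ∑ k ∈ v, lam * (2 * n k + 1 : ℝ) ^ d := by
        rw [Finset.mul_sum, Finset.mul_sum]
        exact Finset.sum_congr rfl fun _ _ => by ring
    _ ≤ 5 ^ d * ∑ k ∈ v, (((latticeBox k (n k)).filter (· ∈ Z)).card : ℝ) := by
        gcongr with k hk
        exact (hn k (hvS k hk)).2.le
    _ ≤ _ := by gcongr

open Classical in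
/-- The event that the random set `{j | ω ∈ E j}` has density larger than `lam` in a cube
centred at `k` of radius at most `N`. -/
def largeDensity {d : ℕ} {Ω : Type*} (E : (Fin d → ℤ) → Set Ω) (lam : ℝ) (N : ℕ)
    (k : Fin d → ℤ) : Set Ω :=
  {ω | ∃ n ≤ N, lam * (2 * n + 1 : ℝ) ^ d < ((latticeBox k n).filter (ω ∈ E ·)).card}

open Classical in
theorem card_filter_eq_sum_indicator {ι Ω : Type*} (s : Finset ι) (E : ι → Set Ω) (ω : Ω) :
    ((s.filter (ω ∈ E ·)).card : ℝ) = ∑ j ∈ s, (E j).indicator (fun _ => (1 : ℝ)) ω := by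
  simp [Set.indicator_apply]

theorem measurableSet_largeDensity {d : ℕ} {Ω : Type*} [MeasurableSpace Ω]
    {E : (Fin d → ℤ) → Set Ω} (hE : ∀ k, MeasurableSet (E k)) (lam : ℝ) (N : ℕ)
    (k : Fin d → ℤ) : MeasurableSet (largeDensity E lam N k) := by
  have : largeDensity E lam N k = ⋃ n ∈ Set.Iic N, {ω | lam * (2 * n + 1 : ℝ) ^ d <
      ∑ j ∈ latticeBox k n, (E j).indicator (fun _ => (1 : ℝ)) ω} := by
    ext ω
    simp [largeDensity, card_filter_eq_sum_indicator]
  rw [this]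
  refine MeasurableSet.biUnion (Set.to_countable _) fun n _ => ?_
  refine measurableSet_lt measurable_const ?_
  exact Finset.measurable_sum _ fun j _ => measurable_const.indicator (hE j)

/-- Weak-type maximal inequality for a stationary family of events indexed by `ℤ^d`. -/
theorem measure_largeDensity_le {d : ℕ} {Ω : Type*} [MeasurableSpace Ω] (P : Measure Ω)
    [IsProbabilityMeasure P] {E : (Fin d → ℤ) → Set Ω} (hE : ∀ k, MeasurableSet (E k))
    {lam : ℝ} (hlam : 0 < lam) (N : ℕ) (hEk : ∀ k, P.real (E k) = P.real (E 0))
    (hW : ∀ k, P.real (largeDensity E lam N k) = P.real (largeDensity E lam N 0)) :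
    lam * P.real (largeDensity E lam N 0) ≤ 10 ^ d * P.real (E 0) := by
  classical
  have hWm := measurableSet_largeDensity hE lam N
  -- The centres range over a box of radius `N`, the maximal scale. The void count then lives in
  -- radius `2 * N`, and the ratio of the two volumes is at most `2 ^ d`, whence `10 ^ d = 5 ^ d * 2
  -- ^ d`.
  have hpt : ∀ ω, lam * ∑ k ∈ latticeBox (0 : Fin d → ℤ) N,
      (largeDensity E lam N k).indicator (fun _ => (1 : ℝ)) ω ≤
      5 ^ d * ∑ k ∈ latticeBox (0 : Fin d → ℤ) (N + N), (E k).indicator (fun _ => (1 : ℝ)) ω := by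
    intro ω
    rw [← card_filter_eq_sum_indicator, ← card_filter_eq_sum_indicator]
    convert card_large_density_le {k | ω ∈ E k} lam hlam N N using 4 <;> ext k <;>
      rw [Finset.mem_filter, Finset.mem_filter] <;> rfl
  have hintW : ∀ k ∈ latticeBox (0 : Fin d → ℤ) N,
      Integrable ((largeDensity E lam N k).indicator (fun _ => (1 : ℝ))) P :=
    fun k _ => (integrable_const _).indicator (hWm k)
  have hintE : ∀ k ∈ latticeBox (0 : Fin d → ℤ) (N + N),
      Integrable ((E k).indicator (fun _ => (1 : ℝ))) P :=
    fun k _ => (integrable_const _).indicator (hE k)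
  have hint := integral_mono ((integrable_finsetSum _ hintW).const_mul lam)
    ((integrable_finsetSum _ hintE).const_mul (5 ^ d)) hpt
  rw [integral_const_mul, integral_const_mul, integral_finsetSum _ hintW,
    integral_finsetSum _ hintE] at hint
  simp only [integral_indicator_const _ (hWm _), integral_indicator_const _ (hE _), smul_eq_mul,
    mul_one, hEk, hW, Finset.sum_const, card_latticeBox, nsmul_eq_mul] at hint
  push_cast at hint
  have hpos : (0 : ℝ) < (2 * N + 1) ^ d := by positivity
  refine le_of_mul_le_mul_left ?_ hpos
  calc (2 * N + 1 : ℝ) ^ d * (lam * P.real (largeDensity E lam N 0))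
      = lam * ((2 * N + 1 : ℝ) ^ d * P.real (largeDensity E lam N 0)) := by ring
    _ ≤ 5 ^ d * ((2 * (N + N) + 1 : ℝ) ^ d * P.real (E 0)) := hint
    _ ≤ 5 ^ d * ((2 * (2 * N + 1) : ℝ) ^ d * P.real (E 0)) := by
        gcongr 5 ^ d * (?_ ^ d * _)
        linarith
    _ = _ := by
        rw [mul_pow 2, show (10 : ℝ) = 5 * 2 by norm_num, mul_pow]
        ring

/-! ### Void lattice points of a stationary matching -/

namespace Matching

variable {d : ℕ}

/-- The matchings without a matched pair in the ball of radius `L` around the lattice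
point `k`. -/
def voidEvent (L : ℕ) (k : Fin d → ℤ) : Set (Matching d) :=
  {m | m.count (Metric.closedBall (latticePoint k) L) (Metric.closedBall (latticePoint k) L) = 0}

theorem mem_voidEvent {L : ℕ} {k : Fin d → ℤ} {m : Matching d} :
    m ∈ voidEvent L k ↔ ∀ x : m.X.carrier, dist (x : Space d) (latticePoint k) ≤ L →
      ¬ dist (m.T x : Space d) (latticePoint k) ≤ L := by
  simp only [voidEvent, count, Set.mem_ofPred_eq, Set.encard_eq_zero, Set.eq_empty_iff_forall_notMem,
    not_and, Metric.mem_closedBall]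

theorem measurable_count {U V : Set (Space d)} (hU : MeasurableSet U) (hV : MeasurableSet V) :
    Measurable fun m : Matching d => m.count U V := by
  refine Measurable.of_comap_le ?_
  exact le_iSup_of_le U (le_iSup_of_le V (le_iSup_of_le hU (le_iSup_of_le hV le_rfl)))

theorem measurableSet_nonempty : MeasurableSet {m : Matching d | m.X.carrier.Nonempty} := by
  have h : {m : Matching d | m.X.carrier.Nonempty}
      = (fun m : Matching d => m.count Set.univ Set.univ) ⁻¹' {0}ᶜ := by
    ext m
    simp [count, Set.encard_eq_zero, Set.nonempty_iff_ne_empty]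
  rw [h]
  exact measurable_count .univ .univ (measurableSet_singleton 0).compl

theorem measurableSet_voidEvent (L : ℕ) (k : Fin d → ℤ) :
    MeasurableSet (voidEvent L k : Set (Matching d)) :=
  measurable_count Metric.isClosed_closedBall.measurableSet
    Metric.isClosed_closedBall.measurableSet (measurableSet_singleton 0)

theorem latticePoint_add (k j : Fin d → ℤ) :
    latticePoint (k + j) = latticePoint k + latticePoint j := by
  ext i
  simp [latticePoint]

/-- Equivariance under shifts, through which invariance of the law makes the void events a
stationary family. -/
theorem vadd_mem_voidEvent {L : ℕ} {k j : Fin d → ℤ} {m : Matching d} :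
    k +ᵥ m ∈ voidEvent L (k + j) ↔ m ∈ voidEvent L j := by
  have hdist : ∀ z : Space d,
      dist z (latticePoint (k + j)) = dist (z - latticePoint k) (latticePoint j) := by
    intro z
    rw [latticePoint_add, dist_eq_norm, dist_eq_norm]
    congr 1
    abel
  rw [mem_voidEvent, mem_voidEvent]
  constructor
  · intro h x hx hT
    have hmem : (x : Space d) + latticePoint k ∈ (k +ᵥ m).X.carrier := by
      change (x : Space d) + latticePoint k - latticePoint k ∈ m.X.carrier
      simp
    refine h ⟨_, hmem⟩ (by rw [hdist]; simpa using hx) ?_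
    rw [hdist]
    change dist ((m.T ⟨(x : Space d) + latticePoint k - latticePoint k, _⟩ : Space d)
      + latticePoint k - latticePoint k) _ ≤ _
    simpa using hT
  · intro h x hx hT
    rw [hdist] at hx hT
    refine h ⟨(x : Space d) - latticePoint k, x.2⟩ hx ?_
    change dist ((m.T ⟨(x : Space d) - latticePoint k, _⟩ : Space d)
      + latticePoint k - latticePoint k) _ ≤ _ at hT
    simpa using hT

theorem vadd_mem_largeDensity {L : ℕ} {lam : ℝ} {N : ℕ} {k : Fin d → ℤ} {m : Matching d} :
    k +ᵥ m ∈ largeDensity (voidEvent L) lam N k ↔ m ∈ largeDensity (voidEvent L) lam N 0 := by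
  classical
  refine exists_congr fun n => and_congr_right fun _ => ?_
  suffices h : ((latticeBox k n).filter (k +ᵥ m ∈ voidEvent L ·)).card
      = ((latticeBox (0 : Fin d → ℤ) n).filter (m ∈ voidEvent L ·)).card by
    rw [h]
  symm
  refine Finset.card_bij (fun j _ => k + j) ?_ (fun _ _ _ _ h => add_left_cancel h) ?_
  · intro j hj
    rw [Finset.mem_filter, mem_latticeBox] at hj ⊢
    exact ⟨by simpa using hj.1, vadd_mem_voidEvent.2 hj.2⟩
  · intro j hj
    refine ⟨j - k, ?_, by simp⟩
    rw [Finset.mem_filter, mem_latticeBox] at hj ⊢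
    refine ⟨by simpa using hj.1, ?_⟩
    rw [← vadd_mem_voidEvent (k := k)]
    simpa using hj.2

theorem measure_largeDensity_voidEvent_le (μ : Measure (Matching d)) [IsProbabilityMeasure μ]
    [VAddInvariantMeasure (Fin d → ℤ) (Matching d) μ] (L : ℕ) {lam : ℝ} (hlam : 0 < lam) (N : ℕ) :
    lam * μ.real (largeDensity (voidEvent L) lam N 0) ≤ 10 ^ d * μ.real (voidEvent L 0) := by
  have hE := measurableSet_voidEvent (d := d) L
  refine measure_largeDensity_le μ hE hlam N (fun k => ?_) (fun k => ?_)
  · have h : (k +ᵥ ·) ⁻¹' voidEvent L k = voidEvent (d := d) L 0 :=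
      Set.ext fun m => by simpa using vadd_mem_voidEvent (L := L) (k := k) (j := 0) (m := m)
    rw [measureReal_def, measureReal_def, ← h,
      VAddInvariantMeasure.measure_preimage_vadd (μ := μ) k (hE k)]
  · have h : (k +ᵥ ·) ⁻¹' largeDensity (voidEvent L) lam N k
        = largeDensity (voidEvent (d := d) L) lam N 0 :=
      Set.ext fun m => Set.mem_preimage.trans
        (vadd_mem_largeDensity (L := L) (lam := lam) (N := N) (k := k) (m := m))
    rw [measureReal_def, measureReal_def, ← h, VAddInvariantMeasure.measure_preimage_vadd (μ := μ) k
      (measurableSet_largeDensity hE lam N k)]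

/-- The events decrease in `L`, and any single matched pair lies in a large enough ball. -/
theorem tendsto_measure_voidEvent (μ : Measure (Matching d)) [IsProbabilityMeasure μ]
    (hne : ∀ᵐ m ∂μ, m.X.carrier.Nonempty) :
    Filter.Tendsto (fun L => μ.real (voidEvent L 0)) Filter.atTop (nhds 0) := by
  have h := tendsto_measure_iInter_atTop (μ := μ) (s := fun L => voidEvent (d := d) L 0)
    (fun L => (measurableSet_voidEvent L 0).nullMeasurableSet)
    (fun L L' hL m hm => by
      rw [mem_voidEvent] at hm ⊢
      have : (L : ℝ) ≤ L' := by exact_mod_cast hL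
      exact fun x hx hT => hm x (hx.trans this) (hT.trans this)) ⟨0, measure_ne_top _ _⟩
  have h0 : μ (⋂ L, voidEvent (d := d) L 0) = 0 := by
    refine measure_mono_null (fun m hm => ?_) hne
    rintro ⟨x, hx⟩
    obtain ⟨L, hL⟩ := exists_nat_ge
      (max (dist x (latticePoint 0)) (dist (m.T ⟨x, hx⟩ : Space d) (latticePoint 0)))
    exact mem_voidEvent.1 (Set.mem_iInter.1 hm L) ⟨x, hx⟩ ((le_max_left _ _).trans hL)
      ((le_max_right _ _).trans hL)
  rw [h0] at h
  exact (ENNReal.tendsto_toReal ENNReal.zero_ne_top).comp h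

/-- Almost surely, for some `L` the set of void lattice points has density at most `lam` in all
cubes centred at the origin. -/
theorem ae_exists_forall_notMem_largeDensity (μ : Measure (Matching d)) [IsProbabilityMeasure μ]
    [VAddInvariantMeasure (Fin d → ℤ) (Matching d) μ]
    (hne : ∀ᵐ m ∂μ, m.X.carrier.Nonempty) {lam : ℝ} (hlam : 0 < lam) :
    ∀ᵐ m ∂μ, ∃ L, ∀ N, m ∉ largeDensity (voidEvent L) lam N 0 := by
  -- The maximal inequality is uniform in `N`, so it survives the union over all scales.
  have hU : ∀ L, μ.real (⋃ N, largeDensity (voidEvent L) lam N 0)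
      ≤ 10 ^ d / lam * μ.real (voidEvent L 0) := by
    intro L
    have hmono : Monotone fun N => largeDensity (voidEvent (d := d) L) lam N 0 :=
      fun N N' h m ⟨n, hn, hm⟩ => ⟨n, hn.trans h, hm⟩
    have ht := (ENNReal.tendsto_toReal (measure_ne_top μ _)).comp
      (tendsto_measure_iUnion_atTop (μ := μ) hmono)
    refine le_of_tendsto' ht fun N => ?_
    rw [div_mul_eq_mul_div, le_div_iff₀ hlam, mul_comm]
    exact measure_largeDensity_voidEvent_le μ L hlam N
  have hle : ∀ L, μ.real (⋂ L, ⋃ N, largeDensity (voidEvent (d := d) L) lam N 0)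
      ≤ 10 ^ d / lam * μ.real (voidEvent L 0) :=
    fun L => (measureReal_mono (Set.iInter_subset _ L)).trans (hU L)
  have hlim := (tendsto_measure_voidEvent μ hne).const_mul (10 ^ d / lam)
  rw [mul_zero] at hlim
  have h0 : μ.real (⋂ L, ⋃ N, largeDensity (voidEvent (d := d) L) lam N 0) = 0 :=
    le_antisymm (ge_of_tendsto' hlim hle) measureReal_nonneg
  rw [measureReal_eq_zero_iff] at h0
  filter_upwards [measure_eq_zero_iff_ae_notMem.1 h0] with m hm
  simpa using hm

end Matching

/-! ### Existence of Poisson points -/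

/-- In positive dimension, a unit intensity Poisson process almost surely has a point. -/
theorem IsUnitPoissonProcess.ae_nonempty {d : ℕ} [NeZero d] {Ω : Type*} [MeasurableSpace Ω]
    {ξ : Ω → PointConfig d} {P : Measure Ω} (hξ : IsUnitPoissonProcess ξ P) :
    ∀ᵐ ω ∂P, (ξ ω).carrier.Nonempty := by
  -- An empty configuration leaves every ball empty, which has probability `exp (-volume)`.
  have hle : ∀ n : ℕ, P {ω | ¬ (ξ ω).carrier.Nonempty}
      ≤ ENNReal.ofReal (Real.exp (-(volume (Metric.closedBall (0 : Space d) n)).toReal)) := by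
    intro n
    have hfin : volume (Metric.closedBall (0 : Space d) n) ≠ ⊤ := measure_closedBall_lt_top.ne
    have hlaw := (hξ.hasLaw_count _ Metric.isClosed_closedBall.measurableSet hfin).measure_eq
      (p := fun c => c = 0) (measurableSet_singleton 0)
    rw [Measure.map_apply (by fun_prop) (.of_discrete),
      show (Nat.cast : ℕ → ℕ∞) ⁻¹' {x | x = 0} = {0} by ext; simp, poissonMeasure_singleton] at hlaw
    calc P {ω | ¬ (ξ ω).carrier.Nonempty}
        ≤ P {ω | (ξ ω).count (Metric.closedBall (0 : Space d) n) = 0} := by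
          refine measure_mono fun ω hω => ?_
          simp [PointConfig.count, Set.not_nonempty_iff_eq_empty.1 hω]
      _ = _ := by
          rw [hlaw]
          simp [ENNReal.coe_toNNReal_eq_toReal]
  have hvol : Filter.Tendsto (fun n : ℕ => (volume (Metric.closedBall (0 : Space d) n)).toReal)
      Filter.atTop Filter.atTop := by
    have h := tendsto_measure_iUnion_atTop (μ := (volume : Measure (Space d)))
      (s := fun n : ℕ => Metric.closedBall (0 : Space d) n)
      (fun n n' h => Metric.closedBall_subset_closedBall (by exact_mod_cast h))
    rw [Metric.iUnion_closedBall_nat, measure_univ_of_isAddLeftInvariant] at h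
    rw [← ENNReal.tendsto_ofReal_nhds_top]
    refine h.congr fun n => ?_
    exact (ENNReal.ofReal_toReal measure_closedBall_lt_top.ne).symm
  have hlim := ENNReal.tendsto_ofReal
    (Real.tendsto_exp_atBot.comp (Filter.tendsto_neg_atTop_atBot.comp hvol))
  rw [ENNReal.ofReal_zero] at hlim
  exact le_antisymm (ge_of_tendsto' hlim hle) bot_le

/-! ### Displacement bounds from monotonicity -/

namespace Matching

variable {d : ℕ}

theorem IsCyclicallyMonotone.inner_sub_nonneg {m : Matching d} (hm : m.IsCyclicallyMonotone)
    (x y : m.X.carrier) :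
    0 ≤ inner ℝ ((m.T x : Space d) - m.T y) ((x : Space d) - y) := by
  by_cases hxy : x = y
  · simp [hxy]
  have h := hm 1 ![x, y] (by
    intro i j hij
    fin_cases i <;> fin_cases j <;> simp_all [eq_comm])
  replace h : 0 ≤ inner ℝ (m.T x : Space d) ((x : Space d) - y)
      + inner ℝ (m.T y : Space d) ((y : Space d) - x) := h.trans_eq (Fin.sum_univ_two _)
  rw [inner_sub_left]
  have : inner ℝ (m.T y : Space d) ((y : Space d) - x)
      = - inner ℝ (m.T y : Space d) ((x : Space d) - y) := by
    rw [← inner_neg_right, neg_sub]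
  linarith

/-- If there is a point with displacement at most `ρ / 2` close to `x + ρ D / |D|`, where `D` is the
displacement of `x`, then `D` is at most `6 ρ`. -/
theorem IsCyclicallyMonotone.norm_displacement_le_of_near {m : Matching d}
    (hm : m.IsCyclicallyMonotone) {ρ : ℝ} (hρ : 0 < ρ) (x y : m.X.carrier)
    (hD : (m.T x : Space d) - x ≠ 0)
    (hy : ‖(y : Space d) - (x + (ρ / ‖(m.T x : Space d) - x‖) • ((m.T x : Space d) - x))‖ ≤ ρ / 2)
    (hTy : ‖(m.T y : Space d) - y‖ ≤ ρ / 2) :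
    ‖(m.T x : Space d) - x‖ ≤ 6 * ρ := by
  have h := hm.inner_sub_nonneg x y
  set D := (m.T x : Space d) - x with hDdef
  set D' := (m.T y : Space d) - y with hD'def
  set w := (y : Space d) - (x + (ρ / ‖D‖) • D) with hw
  have hDpos : 0 < ‖D‖ := norm_pos_iff.2 hD
  -- Here `v = y - x`, and monotonicity reads `⟪D, v⟫ ≤ ‖v‖ ^ 2 + ⟪D', v⟫`. The left side is at
  -- least `ρ * ‖D‖ / 2`, the right side at most `(9 / 4 + 3 / 4) * ρ ^ 2`.
  set v := (ρ / ‖D‖) • D + w with hv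
  have e1 : (m.T x : Space d) - m.T y = -v + D - D' := by
    simp only [hv, hw, hD'def, hDdef]; abel
  have e2 : (x : Space d) - y = -v := by
    simp only [hv, hw]; abel
  have hscal : ‖(ρ / ‖D‖) • D‖ = ρ := by
    rw [norm_smul, Real.norm_of_nonneg (by positivity)]
    field_simp
  have hvn : ‖v‖ ≤ 3 / 2 * ρ := by
    linarith [norm_add_le ((ρ / ‖D‖) • D) w]
  rw [e1, e2, inner_neg_right, inner_sub_left, inner_add_left, inner_neg_left,
    real_inner_self_eq_norm_sq] at h
  have hDv : inner ℝ D v = ρ * ‖D‖ + inner ℝ D w := by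
    rw [hv, inner_add_right, inner_smul_right, real_inner_self_eq_norm_sq]
    field_simp
  have hDw : -(‖D‖ * (ρ / 2)) ≤ inner ℝ D w := by
    have := abs_le.1 (abs_real_inner_le_norm D w)
    nlinarith [mul_le_mul_of_nonneg_left hy hDpos.le]
  have hD'v : inner ℝ D' v ≤ ρ / 2 * (3 / 2 * ρ) :=
    (real_inner_le_norm D' v).trans (mul_le_mul hTy hvn (norm_nonneg _) (by positivity))
  have hv2 : ‖v‖ ^ 2 ≤ (3 / 2 * ρ) ^ 2 := pow_le_pow_left₀ (norm_nonneg _) hvn 2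
  have : ‖D‖ * ρ ≤ 6 * ρ * ρ := by nlinarith
  exact le_of_mul_le_mul_right this hρ

end Matching

theorem EuclideanSpace.norm_le_mul_of_forall_abs_le {d : ℕ} {a : ℝ} (ha : 0 ≤ a)
    (y : EuclideanSpace ℝ (Fin d)) (hy : ∀ i, |y i| ≤ a) : ‖y‖ ≤ d * a := by
  refine le_of_sq_le_sq ?_ (by positivity)
  rw [EuclideanSpace.norm_sq_eq]
  calc ∑ i, ‖y i‖ ^ 2 ≤ ∑ _i : Fin d, a ^ 2 := by
        refine Finset.sum_le_sum fun i _ => pow_le_pow_left₀ (norm_nonneg _) (hy i) 2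
    _ = d * a ^ 2 := by simp
    _ ≤ (d * a) ^ 2 := by
        rw [mul_pow]
        gcongr
        exact_mod_cast Nat.le_self_pow two_ne_zero d

namespace Matching

variable {d : ℕ}

/-- If void lattice points have small density at all scales, then every ball of radius `ρ / 4`
near the cube of side `2 R` contains a lattice point that is not void. -/
theorem exists_notMem_voidEvent [NeZero d] {m : Matching d} {ε R : ℝ} (hε : 0 < ε) (hR : 1 ≤ R)
    {L : ℕ} (hRd : 48 * d ≤ ε * R)
    (hL : ∀ N, m ∉ largeDensity (voidEvent L) ((ε / (24 * d * (7 + 2 * ε))) ^ d) N 0)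
    (z : Space d) (hz : ∀ i, |z i| ≤ R + ε * R / 6) :
    ∃ k : Fin d → ℤ, ‖latticePoint k - z‖ ≤ ε * R / 24 ∧ m ∉ voidEvent L k := by
  classical
  have hd : (1 : ℝ) ≤ d := by exact_mod_cast Nat.one_le_iff_ne_zero.2 (NeZero.ne d)
  have hεR : 0 < ε * R := by positivity
  set t : ℝ := ε * R / (24 * d) with ht
  have htd : d * t = ε * R / 24 := by rw [ht]; field_simp
  have ht2 : 2 ≤ t := by rw [ht, le_div_iff₀ (by positivity)]; linarith
  have htle : t ≤ ε * R / 24 := by rw [← htd]; nlinarith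
  -- One unit of radius is given up because the box is centred at the floor of `z`, so its points
  -- stay within `t` of `z` in each coordinate. As `s ≥ 1`, the side `2 * s + 1` still exceeds `t`.
  obtain ⟨s, hs⟩ : ∃ s : ℕ, ⌊t⌋₊ = s + 1 :=
    ⟨⌊t⌋₊ - 1, by have : 2 ≤ ⌊t⌋₊ := Nat.le_floor (by exact_mod_cast ht2); omega⟩
  have hs1 : 1 ≤ s := by have : 2 ≤ ⌊t⌋₊ := Nat.le_floor (by exact_mod_cast ht2); omega
  have hst : (s : ℝ) + 1 ≤ t := by
    have := Nat.floor_le (show 0 ≤ t by linarith)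
    rw [hs] at this
    exact_mod_cast this
  have hts : t < 2 * s + 1 := by
    have := Nat.lt_floor_add_one t
    rw [hs] at this
    push_cast at this
    have : (1 : ℝ) ≤ s := by exact_mod_cast hs1
    linarith
  have hclose : ∀ k ∈ latticeBox (fun i => ⌊z i⌋) s, ∀ i, |(k i : ℝ) - z i| ≤ t := by
    intro k hk i
    have h1 : |(k i : ℝ) - ⌊z i⌋| ≤ s := by exact_mod_cast mem_latticeBox.1 hk i
    rw [abs_le] at h1 ⊢
    have h2 := Int.floor_le (z i)
    have h3 := Int.lt_floor_add_one (z i)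
    constructor <;> linarith [h1.1, h1.2]
  by_contra! hcon
  have hbad : ∀ k ∈ latticeBox (fun i => ⌊z i⌋) s, m ∈ voidEvent L k := by
    refine fun k hk => hcon k ?_
    rw [← htd]
    exact EuclideanSpace.norm_le_mul_of_forall_abs_le (by linarith) _ (hclose k hk)
  set n := ⌈(2 + ε) * R⌉₊ with hn
  have hsub : latticeBox (fun i => ⌊z i⌋) s
      ⊆ (latticeBox (0 : Fin d → ℤ) n).filter (m ∈ voidEvent L ·) := by
    intro k hk
    refine Finset.mem_filter.2 ⟨mem_latticeBox.2 fun i => ?_, hbad k hk⟩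
    have h1 := hclose k hk i
    have h2 : |(k i : ℝ)| ≤ n := by
      have h3 := abs_sub_abs_le_abs_sub (k i : ℝ) (z i)
      have h4 := Nat.le_ceil ((2 + ε) * R)
      have := hz i
      nlinarith
    simpa using (by exact_mod_cast h2 : |k i| ≤ (n : ℤ))
  have hcard := Finset.card_le_card hsub
  rw [card_latticeBox] at hcard
  have hLn : ¬ (ε / (24 * d * (7 + 2 * ε))) ^ d * (2 * n + 1 : ℝ) ^ d
      < ((latticeBox (0 : Fin d → ℤ) n).filter (m ∈ voidEvent L ·)).card :=
    fun h => hL n ⟨n, le_rfl, h⟩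
  refine hLn ?_
  refine lt_of_lt_of_le ?_ (Nat.cast_le.2 hcard)
  push_cast
  rw [← mul_pow]
  refine pow_lt_pow_left₀ (lt_of_le_of_lt ?_ hts) (by positivity) (NeZero.ne d)
  -- The ceiling and the `+ 1` cost at most `3 ≤ 3 * R`; `lam` is chosen so that its product with
  -- the large volume is at most `t ^ d`.
  have hn1 : (2 * n + 1 : ℝ) ≤ (7 + 2 * ε) * R := by
    have := Nat.ceil_lt_add_one (show 0 ≤ (2 + ε) * R by positivity)
    nlinarith
  calc ε / (24 * d * (7 + 2 * ε)) * (2 * n + 1 : ℝ)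
      ≤ ε / (24 * d * (7 + 2 * ε)) * ((7 + 2 * ε) * R) := by gcongr
    _ = t := by rw [ht]; field_simp

theorem IsCyclicallyMonotone.norm_displacement_le [NeZero d] {m : Matching d}
    (hm : m.IsCyclicallyMonotone) {ε R : ℝ} (hε : 0 < ε) (hR : 1 ≤ R) {L : ℕ}
    (hRd : 48 * d ≤ ε * R) (hRL : 24 * L ≤ ε * R)
    (hL : ∀ N, m ∉ largeDensity (voidEvent L) ((ε / (24 * d * (7 + 2 * ε))) ^ d) N 0)
    (x : m.X.carrier) (hx : ∀ i, (x : Space d) i ∈ Set.Ioo (-R) R) :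
    ‖(m.T x : Space d) - x‖ ≤ ε * R := by
  have hεR : 0 < ε * R := by positivity
  by_cases hD : (m.T x : Space d) - x = 0
  · rw [hD, norm_zero]
    exact hεR.le
  set D := (m.T x : Space d) - x with hDdef
  have hDpos : 0 < ‖D‖ := norm_pos_iff.2 hD
  set ρ := ε * R / 6 with hρ
  have hρpos : 0 < ρ := by positivity
  obtain ⟨k, hk, hvoid⟩ := exists_notMem_voidEvent hε hR hRd hL ((x : Space d) + (ρ / ‖D‖) • D) (by
    intro i
    have h1 : |(x : Space d) i| ≤ R := abs_le.2 ⟨(hx i).1.le, (hx i).2.le⟩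
    have h2 : |((ρ / ‖D‖) • D) i| ≤ ρ := by
      have := PiLp.norm_apply_le ((ρ / ‖D‖) • D) i
      rw [norm_smul, Real.norm_of_nonneg (by positivity : 0 ≤ ρ / ‖D‖),
        div_mul_cancel₀ _ hDpos.ne'] at this
      exact this
    exact (abs_add_le _ _).trans (add_le_add h1 h2))
  rw [mem_voidEvent] at hvoid
  push Not at hvoid
  obtain ⟨y, hy, hTy⟩ := hvoid
  -- Both `L` and the distance from `k` to the target are at most `ρ / 4`, so `y` is within `ρ / 2`
  -- of the target and is displaced by at most `2 * L ≤ ρ / 2`.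
  have hkey := hm.norm_displacement_le_of_near hρpos x y hD (by
    have := norm_sub_le_norm_sub_add_norm_sub (y : Space d) (latticePoint k)
      ((x : Space d) + (ρ / ‖D‖) • D)
    rw [dist_eq_norm] at hy
    linarith) (by
    have := dist_triangle_right (m.T y : Space d) (y : Space d) (latticePoint k)
    rw [dist_eq_norm] at this
    linarith)
  linarith

end Matching

/-! ### The random radius -/

theorem mainTheorem6 {d : ℕ} {Ω : Type*} [MeasurableSpace Ω] (P : Measure Ω)
    [IsProbabilityMeasure P] (M : Ω → Matching d) (hM : Measurable M)
    (hX : IsUnitPoissonProcess (fun ω => (M ω).X) P)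
    (hY : IsUnitPoissonProcess (fun ω => (M ω).Y) P)
    (hXY : IndepFun (fun ω => (M ω).X) (fun ω => (M ω).Y) P)
    (herg : ErgodicVAdd (Fin d → ℤ) (Matching d) (P.map M))
    (hmono : ∀ᵐ ω ∂P, (M ω).IsCyclicallyMonotone) :
    ∀ ε : ℝ, 0 < ε → ∃ r : Ω → ℝ, Measurable r ∧ (∀ ω, 0 < r ω) ∧
      ∀ᵐ ω ∂P, ∀ R : ℝ, r ω ≤ R → ∀ x : (M ω).X.carrier,
        (∀ i, (x : Space d) i ∈ Set.Ioo (-R) R) →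
          ‖((M ω).T x : Space d) - (x : Space d)‖ ≤ ε * R := by
  classical
  intro ε hε
  rcases Nat.eq_zero_or_pos d with rfl | hd
  · refine ⟨fun _ => 1, measurable_const, fun _ => one_pos, .of_forall fun ω R hR x _ => ?_⟩
    rw [Subsingleton.elim ((M ω).T x : Space 0) (x : Space 0), sub_self, norm_zero]
    have : 0 ≤ R := zero_le_one.trans hR
    positivity
  have : NeZero d := ⟨hd.ne'⟩
  have : IsProbabilityMeasure (P.map M) := Measure.isProbabilityMeasure_map hM.aemeasurable
  have hdR : (0 : ℝ) < d := by exact_mod_cast hd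
  set lam : ℝ := (ε / (24 * d * (7 + 2 * ε))) ^ d with hlam
  have hlampos : 0 < lam := by positivity
  let W : ℕ → Set (Matching d) := fun L => ⋃ N, largeDensity (Matching.voidEvent L) lam N 0
  have hWm : ∀ L, MeasurableSet (M ⁻¹' W L) := fun L => hM <| MeasurableSet.iUnion fun N =>
    measurableSet_largeDensity (Matching.measurableSet_voidEvent L) lam N 0
  have hne : ∀ᵐ m ∂(P.map M), m.X.carrier.Nonempty :=
    (ae_map_iff hM.aemeasurable Matching.measurableSet_nonempty).2 hX.ae_nonempty
  have hae : ∀ᵐ ω ∂P, ∃ L, M ω ∉ W L := by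
    filter_upwards [ae_of_ae_map hM.aemeasurable
      (Matching.ae_exists_forall_notMem_largeDensity (P.map M) hne hlampos)] with ω hω
    simpa [W] using hω
  -- The second alternative covers the null event where no `L` works, so that the least `L` is
  -- defined everywhere and measurable.
  let p : Ω → ℕ → Prop := fun ω L => M ω ∉ W L ∨ ∀ L', M ω ∈ W L'
  have hp : ∀ ω, ∃ L, p ω L := by
    intro ω
    by_cases h : ∃ L, M ω ∉ W L
    · exact h.imp fun L hL => Or.inl hL
    · exact ⟨0, Or.inr (by simpa using h)⟩
  have hfind : Measurable fun ω => Nat.find (hp ω) := by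
    refine measurable_find hp fun L => ?_
    have : {ω | p ω L} = (M ⁻¹' W L)ᶜ ∪ ⋂ L', M ⁻¹' W L' := by
      ext ω
      simp [p]
    rw [this]
    exact (hWm L).compl.union (MeasurableSet.iInter hWm)
  -- The three terms ensure `1 ≤ R`, `48 * d ≤ ε * R` and `24 * L ≤ ε * R` respectively.
  refine ⟨fun ω => 1 + 48 * d / ε + 24 / ε * (Nat.find (hp ω) : ℝ), ?_, fun ω => by positivity, ?_⟩
  · exact measurable_const.add
      (measurable_const.mul ((measurable_from_top (f := fun n : ℕ => (n : ℝ))).comp hfind))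
  filter_upwards [hmono, hae] with ω hω hWω R hR x hx
  obtain ⟨L₀, hL₀⟩ := hWω
  have hspec : M ω ∉ W (Nat.find (hp ω)) :=
    (Nat.find_spec (hp ω)).resolve_right fun h => hL₀ (h L₀)
  set L := Nat.find (hp ω)
  have h1 : 0 ≤ 48 * d / ε := by positivity
  have h2 : 0 ≤ 24 / ε * (L : ℝ) := by positivity
  refine hω.norm_displacement_le hε (by linarith) (L := L) ?_ ?_ ?_ x hx
  · have : 48 * d / ε ≤ R := by linarith
    rw [div_le_iff₀ hε] at this
    linarith
  · have : 24 * (L : ℝ) / ε ≤ R := by rw [← div_mul_eq_mul_div]; linarith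
    rw [div_le_iff₀ hε] at this
    linarith
  · simpa [W] using hspec
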